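/- Setting. For $d\ge 1$ let $\mu=\bigotimes_{i=1}^d\mu_i$ be a product of Borel probability measures on $\mathbb{R}$. For each $i$ let $x\mapsto|\varphi_i(x)\rangle=a_i(x)|0\rangle+b_i(x)|1\rangle\in\mathbb{C}^2$ be a measurable embedding into one-qubit pure states, $|a_i(x)|^2+|b_i(x)|^2=1$, with mean density matrix $\rho_{\mu_i}=\int|\varphi_i(y)\rangle\langle\varphi_i(y)|\,\mu_i(dy)$. Let $V$ be a unitary on $(\mathbb{C}^2)^{\otimes d}$, and for $x\in\mathbb{R}^d$ let $|\psi(x)\rangle=V\bigotimes_{i=1}^d|\varphi_i(x_i)\rangle$, $\rho(x)=|\psi(x)\rangle\langle\psi(x)|$ and $k(x,x')=\operatorname{tr}(\rho(x)\rho(x'))$ (the $d$-qubit quantum kernel). Let $(X,Y)\sim\mathcal{D}$ with $X\sim\mu$ and $Y=f(X)+\xi$, where $f\in L^2(\mu)$, $\xi$ is integrable and $\mathbb{E}[\xi\mid X]=0$ (the noiseless case $\xi=0$ is included). Given $n$ i.i.d. samples $(x^{(i)},y^{(i)})$ from $\mathcal{D}$ with kernel matrix $K_{ij}=k(x^{(i)},x^{(j)})$,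 the kernel ridge regression estimator is $\hat f_n^\lambda=\sum_{i=1}^n\alpha_i\,k(x^{(i)},\cdot)$ with $\alpha=(K+\lambda\,\mathrm{id})^{-1}y$. The risk of $h:\mathbb{R}^d\to\mathbb{R}$ is $R(h)=\mathbb{E}_{(X,Y)\sim\mathcal{D}}\big[(h(X)-Y)^2\big]\in[0,\infty]$, and $\|f\|$ is the $L^2(\mu)$ norm. Theorem. For all $\delta<1$, $l\in\mathbb{N}$ and $\varepsilon>0$ there is $d_0=d_0(\delta,l,\varepsilon)$ such that the following holds for all $d\ge d_0$, all $n\le d^l$, and all $\mu_i$, $\varphi_i$ and $V$ as above with $\operatorname{tr}(\rho_{\mu_i}^2)\le\delta$ for every $i=1,\dots,d$. For every $f\in L^2(\mu)$ and every law $\mathcal{D}$ as above, with probability at least $1-\varepsilon$ over the sample, simultaneously for all $\lambda\ge0$ the matrix $K+\lambda\,\mathrm{id}$ is invertible (so that $\hat f_n^\lambda$ is well defined) and $$R(\hat f_n^\lambda)\ \ge\ (1-\varepsilon)\,\|f\|^2 .$$ -/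

import Mathlib

open MeasureTheory

noncomputable section

namespace QuantumKernel

/-- The density matrix `|ψ⟩⟨ψ|` of a vector `ψ`. -/
def density {ι : Type*} (ψ : ι → ℂ) : Matrix ι ι ℂ :=
  Matrix.vecMulVec ψ (star ψ)

/-- A measurable embedding of a real variable into the pure states of one qubit,
`x ↦ |φ(x)⟩ = a(x)|0⟩ + b(x)|1⟩` with `|a(x)|² + |b(x)|² = 1`. -/
structure IsQubitEmbedding (φ : ℝ → Fin 2 → ℂ) : Prop where
  measurable : Measurable φ
  normalized : ∀ x, ∑ b, ‖φ x b‖ ^ 2 = 1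

/-- The mean density matrix `∫ |φ(y)⟩⟨φ(y)| ν(dy)` of a one-qubit embedding
(the integral is taken entrywise). -/
def meanDensity (φ : ℝ → Fin 2 → ℂ) (ν : Measure ℝ) : Matrix (Fin 2) (Fin 2) ℂ :=
  Matrix.of fun a b => ∫ y, density (φ y) a b ∂ν

/-- The purity `tr(ρ²)`; for a Hermitian matrix `ρ` this trace is a real number. -/
def purity {ι : Type*} [Fintype ι] (ρ : Matrix ι ι ℂ) : ℝ :=
  (ρ * ρ).trace.re

/-- The `d`-qubit product vector `⨂ᵢ |φᵢ(xᵢ)⟩`, in coordinates with respect to the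
computational basis, which is indexed by the bit strings `Fin d → Fin 2`. -/
def productState {d : ℕ} (φ : Fin d → ℝ → Fin 2 → ℂ) (x : Fin d → ℝ) :
    (Fin d → Fin 2) → ℂ :=
  fun b => ∏ i, φ i (x i) (b i)

/-- The density matrix of the `d`-qubit state `V ⨂ᵢ |φᵢ(xᵢ)⟩`, where `V` is unitary. -/
def featureMap {d : ℕ} (φ : Fin d → ℝ → Fin 2 → ℂ)
    (V : Matrix.unitaryGroup (Fin d → Fin 2) ℂ) (x : Fin d → ℝ) :
    Matrix (Fin d → Fin 2) (Fin d → Fin 2) ℂ :=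
  density (Matrix.mulVec (V : Matrix (Fin d → Fin 2) (Fin d → Fin 2) ℂ) (productState φ x))

/-- The quantum kernel `k(x, x') = tr(ρ(x) ρ(x'))`; this trace is a real number. -/
def kernel {d : ℕ} (φ : Fin d → ℝ → Fin 2 → ℂ)
    (V : Matrix.unitaryGroup (Fin d → Fin 2) ℂ) (x x' : Fin d → ℝ) : ℝ :=
  (featureMap φ V x * featureMap φ V x').trace.re

/-- The regularized kernel matrix `K(X, X) + t · id` of the inputs of a labelled sample. -/
def ridgeMatrix {X : Type*} (k : X → X → ℝ) {n : ℕ} (S : Fin n → X × ℝ) (t : ℝ) :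
    Matrix (Fin n) (Fin n) ℝ :=
  (Matrix.of fun i j => k (S i).1 (S j).1) + t • (1 : Matrix (Fin n) (Fin n) ℝ)

/-- The kernel ridge regression estimator `∑ᵢ αᵢ k(xᵢ, ·)`,
`α = (K(X, X) + t · id)⁻¹ y`, of a labelled sample. -/
def krr {X : Type*} (k : X → X → ℝ) {n : ℕ} (S : Fin n → X × ℝ) (t : ℝ) (x : X) : ℝ :=
  ∑ i, Matrix.mulVec (ridgeMatrix k S t)⁻¹ (fun j => (S j).2) i * k (S i).1 x

/-- The least-squares risk `E (h(X) - Y)²` for `(X, Y) ∼ D`, a value in `[0, ∞]`. -/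
def risk {X : Type*} [MeasurableSpace X] (D : Measure (X × ℝ)) (h : X → ℝ) : ENNReal :=
  ∫⁻ p, ENNReal.ofReal ((h p.1 - p.2) ^ 2) ∂D

/-- `D` is the law of a pair `(X, Y)` with `X ∼ μ` and `Y = f(X) + ξ`, where the noise `ξ` is
integrable with `E[ξ | X] = 0`. The noiseless case `ξ = 0` is included. -/
structure IsRegressionLaw {X : Type*} [MeasurableSpace X] (D : Measure (X × ℝ))
    (μ : Measure X) (f : X → ℝ) : Prop where
  map_fst : D.map Prod.fst = μ
  integrable_noise : Integrable (fun p : X × ℝ => p.2 - f p.1) D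
  condExp_noise :
    condExp (MeasurableSpace.comap (Prod.fst : X × ℝ → X) inferInstance) D
      (fun p => p.2 - f p.1) =ᵐ[D] 0

end QuantumKernel

end

open MeasureTheory

noncomputable section

namespace QuantumKernel

/-! ### Inner products and norms in real L² as integrals. -/

section L2

variable {X : Type*} [MeasurableSpace X] {μ : Measure X}

/-! Labels and λ only choose coefficients: the estimator always lies in the span of the n kernel
functions at the sample points. Its risk is therefore at least the squared L²(μ) distance from `f`
to that span, since centred noise can only add to it. This is why one event of sample points serves
all λ at once.

In high dimension these n functions are nearly orthogonal to each other and, on average, to any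
fixed `f`. The unitary cancels, so the kernel is a product of one-qubit kernels and the mean squared
cosine between two random kernel functions is a product of d one-qubit means (`cosSq_prod`). Each
factor is at most some c < 1 depending only on δ (`integral_integral_cosSq_le`): purity below 1
keeps the trace-one second moment matrix of the four real one-qubit features away from rank one. So
the mean squared cosine is at most c^d.

When the sampled functions v_i are nearly orthogonal, the span captures at most 2 ∑ ⟨f, v_i⟩² /
‖v_i‖² of ‖f‖² (`norm_sq_sub_le_norm_sub_sum_sq`). The mean of one summand, without the factor 2, is
at most ‖f‖² times the Hilbert–Schmidt norm of the second moment operator of the normalized kernel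
functions, and this norm is the square root of the mean squared cosine
(`lintegral_sq_integral_mul_div_gram_le`).

The mean kernel value is also exponentially small, so the kernel matrix is diagonally dominant with
high probability. Markov's inequality for all three effects together (`measure_not_le_risk_krr_le`)
gives failure probability at most a constant times n² c^(d/2), which tends to 0 for n ≤ d^l. -/

lemma inner_toLp_eq_integral {f g : X → ℝ} (hf : MemLp f 2 μ) (hg : MemLp g 2 μ) :
    inner ℝ (hf.toLp f) (hg.toLp g) = ∫ x, f x * g x ∂μ := by
  rw [L2.inner_def]
  refine integral_congr_ae ?_
  filter_upwards [hf.coeFn_toLp, hg.coeFn_toLp] with x h1 h2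
  simp [h1, h2, mul_comm]

lemma norm_toLp_sq_eq_integral {f : X → ℝ} (hf : MemLp f 2 μ) :
    ‖hf.toLp f‖ ^ 2 = ∫ x, f x ^ 2 ∂μ := by
  rw [← real_inner_self_eq_norm_sq, inner_toLp_eq_integral]
  simp [sq]

lemma sq_integral_mul_le {f g : X → ℝ} (hf : MemLp f 2 μ) (hg : MemLp g 2 μ) :
    (∫ x, f x * g x ∂μ) ^ 2 ≤ (∫ x, f x ^ 2 ∂μ) * ∫ x, g x ^ 2 ∂μ := by
  have := real_inner_mul_inner_self_le (hf.toLp f) (hg.toLp g)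
  rw [real_inner_self_eq_norm_sq, real_inner_self_eq_norm_sq, norm_toLp_sq_eq_integral,
    norm_toLp_sq_eq_integral, inner_toLp_eq_integral] at this
  rwa [sq]

end L2

/-! ### Kernels with values in [0, 1] and the angles between their kernel functions. -/

/-- A jointly measurable kernel with values in `[0, 1]` which is `1` on the diagonal. -/
structure IsUnitKernel {X : Type*} [MeasurableSpace X] (k : X → X → ℝ) : Prop where
  measurable : Measurable (Function.uncurry k)
  nonneg : ∀ x z, 0 ≤ k x z
  le_one : ∀ x z, k x z ≤ 1
  diag : ∀ x, k x x = 1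

/-- The `L²(μ)` inner product of the kernel functions at `x` and `x'`. -/
def gram {X : Type*} [MeasurableSpace X] (μ : Measure X) (k : X → X → ℝ) (x x' : X) : ℝ :=
  ∫ z, k x z * k x' z ∂μ

/-- The squared cosine of the angle in `L²(μ)` between the kernel functions at `x` and `x'`,
with the value `0` if one of the two vanishes. -/
def cosSq {X : Type*} [MeasurableSpace X] (μ : Measure X) (k : X → X → ℝ) (x x' : X) : ℝ :=
  gram μ k x x' ^ 2 / (gram μ k x x * gram μ k x' x')

section UnitKernel

variable {X : Type*} [MeasurableSpace X] {μ : Measure X} [IsProbabilityMeasure μ]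
  {k : X → X → ℝ}

lemma IsUnitKernel.memLp (hk : IsUnitKernel k) (x : X) : MemLp (k x) 2 μ :=
  MemLp.of_bound (hk.measurable.of_uncurry_left.aestronglyMeasurable) 1
    (ae_of_all _ fun z => by rw [Real.norm_of_nonneg (hk.nonneg x z)]; exact hk.le_one x z)

lemma integrable_of_mem_Icc {Y : Type*} [MeasurableSpace Y] {ν : Measure Y}
    [IsFiniteMeasure ν] {g : Y → ℝ} (hg : Measurable g) (h0 : ∀ y, 0 ≤ g y) (h1 : ∀ y, g y ≤ 1) :
    Integrable g ν :=
  Integrable.of_bound hg.aestronglyMeasurable 1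
    (ae_of_all _ fun z => by rw [Real.norm_of_nonneg (h0 z)]; exact h1 z)

lemma integral_mem_Icc {Y : Type*} [MeasurableSpace Y] {ν : Measure Y}
    [IsProbabilityMeasure ν] {g : Y → ℝ} (hg : Measurable g) (h0 : ∀ y, 0 ≤ g y)
    (h1 : ∀ y, g y ≤ 1) : ∫ y, g y ∂ν ∈ Set.Icc (0 : ℝ) 1 := by
  refine ⟨integral_nonneg h0, ?_⟩
  have := integral_mono (integrable_of_mem_Icc (ν := ν) hg h0 h1) (integrable_const (1 : ℝ)) h1
  simpa using this

lemma integrable_integral_of_mem_Icc {g : X → X → ℝ} (hg : Measurable (Function.uncurry g))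
    (h0 : ∀ x z, 0 ≤ g x z) (h1 : ∀ x z, g x z ≤ 1) : Integrable (fun x => ∫ z, g x z ∂μ) μ :=
  integrable_of_mem_Icc hg.stronglyMeasurable.integral_prod_right.measurable
    (fun x => (integral_mem_Icc hg.of_uncurry_left (h0 x) (h1 x)).1)
    (fun x => (integral_mem_Icc hg.of_uncurry_left (h0 x) (h1 x)).2)

lemma measurable_gram (hk : Measurable (Function.uncurry k)) :
    Measurable fun p : X × X => gram μ k p.1 p.2 := by
  have h1 : Measurable fun q : (X × X) × X => k q.1.1 q.2 :=
    hk.comp ((measurable_fst.comp measurable_fst).prodMk measurable_snd)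
  have h2 : Measurable fun q : (X × X) × X => k q.1.2 q.2 :=
    hk.comp ((measurable_snd.comp measurable_fst).prodMk measurable_snd)
  exact ((h1.mul h2).stronglyMeasurable.integral_prod_right (ν := μ)).measurable

lemma measurable_gram_self (hk : Measurable (Function.uncurry k)) :
    Measurable fun x : X => gram μ k x x :=
  (measurable_gram (μ := μ) hk).comp (measurable_id.prodMk measurable_id)

lemma measurable_cosSq (hk : Measurable (Function.uncurry k)) :
    Measurable fun p : X × X => cosSq μ k p.1 p.2 :=
  ((measurable_gram hk).pow_const 2).div
    (((measurable_gram_self hk).comp measurable_fst).mul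
      ((measurable_gram_self hk).comp measurable_snd))

lemma gram_mem_Icc (hk : IsUnitKernel k) (x x' : X) : gram μ k x x' ∈ Set.Icc (0 : ℝ) 1 :=
  integral_mem_Icc (hk.measurable.of_uncurry_left.mul hk.measurable.of_uncurry_left)
    (fun z => mul_nonneg (hk.nonneg x z) (hk.nonneg x' z))
    (fun z => mul_le_one₀ (hk.le_one x z) (hk.nonneg x' z) (hk.le_one x' z))

lemma gram_sq_le (hk : IsUnitKernel k) (x x' : X) :
    gram μ k x x' ^ 2 ≤ gram μ k x x * gram μ k x' x' := by
  have := sq_integral_mul_le (hk.memLp (μ := μ) x) (hk.memLp x')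
  simpa only [gram, sq] using this

lemma cosSq_nonneg (hk : IsUnitKernel k) (x x' : X) : 0 ≤ cosSq μ k x x' :=
  div_nonneg (sq_nonneg _) (mul_nonneg (gram_mem_Icc hk x x).1 (gram_mem_Icc hk x' x').1)

lemma cosSq_le_one (hk : IsUnitKernel k) (x x' : X) : cosSq μ k x x' ≤ 1 :=
  div_le_one_of_le₀ (gram_sq_le hk x x')
    (mul_nonneg (gram_mem_Icc hk x x).1 (gram_mem_Icc hk x' x').1)

/-- Write a for the product of the two diagonal Gram values and g for the squared mixed one. Since a
≤ 1, a - g = a (1 - g / a) ≤ 1 - g / a. This replaces the quotient by polynomial quantities whose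
means can be computed from second moments. -/
lemma gram_mul_gram_sub_le (hk : IsUnitKernel k) (x x' : X) :
    gram μ k x x * gram μ k x' x' - gram μ k x x' ^ 2 ≤ 1 - cosSq μ k x x' := by
  have h := gram_sq_le (μ := μ) hk x x'
  have h0 : 0 ≤ gram μ k x x * gram μ k x' x' :=
    mul_nonneg (gram_mem_Icc hk x x).1 (gram_mem_Icc hk x' x').1
  have h1 : gram μ k x x * gram μ k x' x' ≤ 1 :=
    mul_le_one₀ (gram_mem_Icc hk x x).2 (gram_mem_Icc hk x' x').1 (gram_mem_Icc hk x' x').2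
  unfold cosSq
  set a := gram μ k x x * gram μ k x' x'
  set g := gram μ k x x' ^ 2
  rcases h0.eq_or_lt with h0 | h0
  · rw [← h0] at h ⊢
    have : 0 ≤ g := sq_nonneg _
    simp; linarith
  · have h2 : g / a ≤ 1 := div_le_one_of_le₀ h h0.le
    have h3 : g = a * (g / a) := by field_simp
    nlinarith

end UnitKernel

/-! ### Finitely many features: the mean squared cosine is bounded away from 1. -/

section FiniteFeatures

variable {X : Type*} [MeasurableSpace X] {μ : Measure X} [IsProbabilityMeasure μ]
  {ι : Type*} [Fintype ι]

/-- The right side is (tr C²)² - tr C⁴, which is half the sum of the squares of all 2 × 2 minors of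
C. Keeping only the principal minors, whose sum is (tr C)² - tr C², and applying Cauchy–Schwarz over
the card² index pairs gives the left side. -/
lemma sq_sum_sub_le_of_symm (C : ι → ι → ℝ) (hC : ∀ i j, C i j = C j i) :
    (((∑ i, C i i) ^ 2 - ∑ i, ∑ j, C i j ^ 2) ^ 2) / (2 * Fintype.card ι ^ 2) ≤
      (∑ i, ∑ j, C i j ^ 2) ^ 2 - ∑ a, ∑ b, ∑ c, ∑ d, C a b * C c d * (C a c * C b d) := by
  classical
  have hW : ∑ p : (ι × ι) × (ι × ι),
      (C p.1.1 p.2.1 * C p.1.2 p.2.2 - C p.1.1 p.2.2 * C p.1.2 p.2.1) ^ 2 =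
      2 * ((∑ i, ∑ j, C i j ^ 2) ^ 2 -
        ∑ a, ∑ b, ∑ c, ∑ d, C a b * C c d * (C a c * C b d)) := by
    have e1 : ∑ p : (ι × ι) × (ι × ι), (C p.1.1 p.2.1 * C p.1.2 p.2.2) ^ 2 =
        (∑ i, ∑ j, C i j ^ 2) ^ 2 := by
      simp only [Fintype.sum_prod_type, sq (∑ i, ∑ j, C i j ^ 2), Finset.sum_mul_sum, mul_pow]
    have e2 : ∑ p : (ι × ι) × (ι × ι), (C p.1.1 p.2.2 * C p.1.2 p.2.1) ^ 2 =
        (∑ i, ∑ j, C i j ^ 2) ^ 2 := by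
      rw [← e1]
      refine Fintype.sum_equiv ((Equiv.refl _).prodCongr (Equiv.prodComm ι ι)) _ _ fun p => ?_
      simp
    have e3 : ∑ p : (ι × ι) × (ι × ι),
        C p.1.1 p.2.1 * C p.1.2 p.2.2 * (C p.1.1 p.2.2 * C p.1.2 p.2.1) =
        ∑ a, ∑ b, ∑ c, ∑ d, C a b * C c d * (C a c * C b d) := by
      simp only [Fintype.sum_prod_type]
      refine Finset.sum_congr rfl fun a _ => ?_
      rw [Finset.sum_comm]
      refine Finset.sum_congr rfl fun c _ => ?_
      rw [Finset.sum_comm]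
      refine Finset.sum_congr rfl fun b _ => ?_
      refine Finset.sum_congr rfl fun d _ => ?_
      rw [hC d b, hC d c]
    have e4 : ∀ p : (ι × ι) × (ι × ι),
      (C p.1.1 p.2.1 * C p.1.2 p.2.2 - C p.1.1 p.2.2 * C p.1.2 p.2.1) ^ 2 =
      (C p.1.1 p.2.1 * C p.1.2 p.2.2) ^ 2 + (C p.1.1 p.2.2 * C p.1.2 p.2.1) ^ 2 -
      2 * (C p.1.1 p.2.1 * C p.1.2 p.2.2 * (C p.1.1 p.2.2 * C p.1.2 p.2.1)) := fun p => by ring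
    simp only [e4, Finset.sum_sub_distrib, Finset.sum_add_distrib, ← Finset.mul_sum]
    rw [e1, e2, e3]; ring
  have hm : ∑ p : ι × ι, (C p.1 p.1 * C p.2 p.2 - C p.1 p.2 * C p.2 p.1) ^ 2 ≤
      ∑ p : (ι × ι) × (ι × ι),
      (C p.1.1 p.2.1 * C p.1.2 p.2.2 - C p.1.1 p.2.2 * C p.1.2 p.2.1) ^ 2 := by
    rw [Fintype.sum_prod_type (f := fun p : (ι × ι) × (ι × ι) =>
      (C p.1.1 p.2.1 * C p.1.2 p.2.2 - C p.1.1 p.2.2 * C p.1.2 p.2.1) ^ 2)]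
    refine Finset.sum_le_sum fun p _ => ?_
    exact Finset.single_le_sum (f := fun q : ι × ι =>
      (C p.1 q.1 * C p.2 q.2 - C p.1 q.2 * C p.2 q.1) ^ 2) (fun q _ => sq_nonneg _)
      (Finset.mem_univ p)
  have hs : ∑ p : ι × ι, (C p.1 p.1 * C p.2 p.2 - C p.1 p.2 * C p.2 p.1) =
      (∑ i, C i i) ^ 2 - ∑ i, ∑ j, C i j ^ 2 := by
    rw [Finset.sum_sub_distrib, Fintype.sum_prod_type, Fintype.sum_prod_type, sq,
      Finset.sum_mul_sum]
    congr 1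
    refine Finset.sum_congr rfl fun a _ => Finset.sum_congr rfl fun b _ => ?_
    simp only [hC b a, sq]
  have hcs := sq_sum_le_card_mul_sum_sq (s := (Finset.univ : Finset (ι × ι)))
    (f := fun p => C p.1 p.1 * C p.2 p.2 - C p.1 p.2 * C p.2 p.1)
  rw [hs] at hcs
  have hcard : ((Finset.univ : Finset (ι × ι)).card : ℝ) = (Fintype.card ι : ℝ) ^ 2 := by
    simp [sq]
  rw [hcard] at hcs
  refine div_le_of_le_mul₀ (by positivity) ?_ ?_
  · nlinarith [hm, hW, Finset.sum_nonneg (s := (Finset.univ : Finset ((ι × ι) × (ι × ι))))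
      (f := fun p => (C p.1.1 p.2.1 * C p.1.2 p.2.2 - C p.1.1 p.2.2 * C p.1.2 p.2.1) ^ 2)
      (fun p _ => sq_nonneg _)]
  · have := mul_le_mul_of_nonneg_left (hm.trans hW.le) (sq_nonneg (Fintype.card ι : ℝ))
    linarith

variable {r : ι → X → ℝ}

/-- With C the second moment matrix of the features, tr C = 1 because `k` is 1 on the diagonal, the
mean of `gram` on the diagonal is tr C², and the mean of `gram` squared is tr C⁴. Averaging
`gram_mul_gram_sub_le` bounds one minus the mean squared cosine below by (tr C²)² - tr C⁴, to which
the minor inequality applies. -/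
lemma integral_integral_cosSq_le {k : X → X → ℝ} (hk : IsUnitKernel k)
    (hr : ∀ a, Measurable (r a)) (hkr : ∀ x z, k x z = ∑ a, r a x * r a z) {δ : ℝ} (hδ : δ ≤ 1)
    (hkδ : ∫ x, ∫ z, k x z ∂μ ∂μ ≤ δ) :
    ∫ x, ∫ z, cosSq μ k x z ∂μ ∂μ ≤ 1 - (1 - δ) ^ 2 / (2 * Fintype.card ι ^ 2) := by
  have hb : ∀ a x, |r a x| ≤ 1 := fun a x => by
    rw [← sq_le_one_iff_abs_le_one, ← hk.diag x, hkr, sq]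
    exact Finset.single_le_sum (f := fun a => r a x * r a x) (fun a _ => mul_self_nonneg _)
      (Finset.mem_univ a)
  have hL : ∀ a, MemLp (r a) 2 μ := fun a =>
    MemLp.of_bound (hr a).aestronglyMeasurable 1 (ae_of_all _ (hb a))
  have hI : ∀ a b, Integrable (fun x => r a x * r b x) μ := fun a b =>
    (hL a).integrable_mul (hL b)
  set C : ι → ι → ℝ := fun a b => ∫ x, r a x * r b x ∂μ with hCdef
  have hC : ∀ a b, C a b = C b a := fun a b => by simp only [hCdef, mul_comm]
  have hgram : ∀ x x', gram μ k x x' = ∑ a, ∑ b, C a b * (r a x * r b x') := fun x x' => by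
    have : ∀ z, k x z * k x' z = ∑ a, ∑ b, r a z * r b z * (r a x * r b x') := fun z => by
      rw [hkr, hkr, Finset.sum_mul_sum]
      exact Finset.sum_congr rfl fun a _ => Finset.sum_congr rfl fun b _ => by ring
    simp only [gram, this]
    rw [integral_finsetSum _ fun a _ => integrable_finsetSum _ fun b _ => (hI a b).mul_const _]
    refine Finset.sum_congr rfl fun a _ => ?_
    rw [integral_finsetSum _ fun b _ => (hI a b).mul_const _]
    exact Finset.sum_congr rfl fun b _ => integral_mul_const _ _
  have htr : ∑ a, C a a = 1 := by
    simp only [hCdef]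
    rw [← integral_finsetSum _ fun a _ => hI a a]
    simp only [← hkr, hk.diag]
    simp
  have hp : ∫ x, gram μ k x x ∂μ = ∑ a, ∑ b, C a b ^ 2 := by
    simp only [hgram]
    rw [integral_finsetSum _ fun a _ => integrable_finsetSum _ fun b _ => (hI a b).const_mul _]
    refine Finset.sum_congr rfl fun a _ => ?_
    rw [integral_finsetSum _ fun b _ => (hI a b).const_mul _]
    refine Finset.sum_congr rfl fun b _ => ?_
    rw [integral_const_mul, sq]
  have hq : ∫ x, ∫ x', gram μ k x x' ^ 2 ∂μ ∂μ =
      ∑ a, ∑ b, ∑ c, ∑ d, C a b * C c d * (C a c * C b d) := by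
    have e : ∀ x x', gram μ k x x' ^ 2 =
        ∑ a, ∑ b, ∑ c, ∑ d, (C a b * C c d * (r a x * r c x)) * (r b x' * r d x') := by
      intro x x'
      simp only [hgram, sq, Finset.sum_mul_sum]
      refine Finset.sum_congr rfl fun a _ => Finset.sum_comm.trans ?_
      refine Finset.sum_congr rfl fun b _ => Finset.sum_congr rfl fun c _ =>
        Finset.sum_congr rfl fun d _ => by ring
    have e' : ∀ x, ∫ x', gram μ k x x' ^ 2 ∂μ =
        ∑ a, ∑ b, ∑ c, ∑ d, (C a b * C c d * (r a x * r c x)) * C b d := by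
      intro x
      simp only [e]
      have i4 := fun a b c d => (hI b d).const_mul (C a b * C c d * (r a x * r c x))
      have i3 := fun a b c => integrable_finsetSum Finset.univ fun d _ => i4 a b c d
      have i2 := fun a b => integrable_finsetSum Finset.univ fun c _ => i3 a b c
      have i1 := fun a => integrable_finsetSum Finset.univ fun b _ => i2 a b
      rw [integral_finsetSum _ fun a _ => i1 a]
      refine Finset.sum_congr rfl fun a _ => ?_
      rw [integral_finsetSum _ fun b _ => i2 a b]
      refine Finset.sum_congr rfl fun b _ => ?_
      rw [integral_finsetSum _ fun c _ => i3 a b c]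
      refine Finset.sum_congr rfl fun c _ => ?_
      rw [integral_finsetSum _ fun d _ => i4 a b c d]
      exact Finset.sum_congr rfl fun d _ => integral_const_mul _ _
    simp only [e']
    have i4 := fun a b c d => ((hI a c).const_mul (C a b * C c d)).mul_const (C b d)
    have i3 := fun a b c => integrable_finsetSum Finset.univ fun d _ => i4 a b c d
    have i2 := fun a b => integrable_finsetSum Finset.univ fun c _ => i3 a b c
    have i1 := fun a => integrable_finsetSum Finset.univ fun b _ => i2 a b
    rw [integral_finsetSum _ fun a _ => i1 a]
    refine Finset.sum_congr rfl fun a _ => ?_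
    rw [integral_finsetSum _ fun b _ => i2 a b]
    refine Finset.sum_congr rfl fun b _ => ?_
    rw [integral_finsetSum _ fun c _ => i3 a b c]
    refine Finset.sum_congr rfl fun c _ => ?_
    rw [integral_finsetSum _ fun d _ => i4 a b c d]
    refine Finset.sum_congr rfl fun d _ => ?_
    rw [integral_mul_const, integral_const_mul]; ring
  -- tr C² is the mean of k², and k² ≤ k on [0, 1].
  have hpδ : ∑ a, ∑ b, C a b ^ 2 ≤ δ := by
    rw [← hp]
    refine le_trans (integral_mono ?_ ?_ fun x => ?_) hkδ
    · exact integrable_of_mem_Icc (measurable_gram_self hk.measurable)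
        (fun x => (gram_mem_Icc hk x x).1) (fun x => (gram_mem_Icc hk x x).2)
    · exact integrable_integral_of_mem_Icc hk.measurable hk.nonneg hk.le_one
    · refine integral_mono ((hk.memLp x).integrable_mul (hk.memLp x))
        ((hk.memLp x).integrable (by norm_num)) fun z => ?_
      exact mul_le_of_le_one_left (hk.nonneg x z) (hk.le_one x z)
  have hmain := sq_sum_sub_le_of_symm C hC
  rw [htr, ← hq] at hmain
  set p := ∑ a, ∑ b, C a b ^ 2
  have hδp : (1 - δ) ^ 2 / (2 * Fintype.card ι ^ 2) ≤
      ((1 : ℝ) ^ 2 - p) ^ 2 / (2 * Fintype.card ι ^ 2) := by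
    gcongr
    linarith
  have hcm := measurable_cosSq (μ := μ) hk.measurable
  have hgm := measurable_gram (μ := μ) hk.measurable
  have hg1 := fun x x' => gram_mem_Icc (μ := μ) hk x x'
  have hgs : ∀ x x', gram μ k x x' ^ 2 ≤ 1 := fun x x' =>
    pow_le_one₀ (hg1 x x').1 (hg1 x x').2
  have hgms : Measurable fun p : X × X => gram μ k p.1 p.2 ^ 2 := hgm.pow_const 2
  have hgself := measurable_gram_self (μ := μ) hk.measurable
  have hin : Integrable (fun x => ∫ x', gram μ k x x' ^ 2 ∂μ) μ :=
    integrable_integral_of_mem_Icc hgms (fun _ _ => sq_nonneg _) hgs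
  have hic : Integrable (fun x => ∫ x', cosSq μ k x x' ∂μ) μ :=
    integrable_integral_of_mem_Icc hcm (cosSq_nonneg hk) (cosSq_le_one hk)
  have hig := integrable_of_mem_Icc (ν := μ) hgself (fun x => (hg1 x x).1) (fun x => (hg1 x x).2)
  have key : ∫ x, ((gram μ k x x) * p - ∫ x', gram μ k x x' ^ 2 ∂μ) ∂μ ≤
      ∫ x, (1 - ∫ z, cosSq μ k x z ∂μ) ∂μ := by
    refine integral_mono ((hig.mul_const p).sub hin) ((integrable_const 1).sub hic) fun x => ?_
    have i1 : Integrable (fun x' => gram μ k x x' ^ 2) μ :=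
      integrable_of_mem_Icc (hgms.comp measurable_prodMk_left) (fun _ => sq_nonneg _) (hgs x)
    have i2 : Integrable (fun x' => cosSq μ k x x') μ :=
      integrable_of_mem_Icc hcm.of_uncurry_left (cosSq_nonneg hk x) (cosSq_le_one hk x)
    have := integral_mono ((hig.const_mul (gram μ k x x)).sub i1) ((integrable_const 1).sub i2)
      fun x' => gram_mul_gram_sub_le (μ := μ) hk x x'
    simp only [Pi.sub_apply] at this
    rw [integral_sub (hig.const_mul _) i1, integral_sub (integrable_const 1) i2,
      integral_const_mul, hp] at this
    simpa using this
  rw [integral_sub (hig.mul_const p) hin, integral_sub (integrable_const 1) hic,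
    integral_mul_const, hp] at key
  simp only [integral_const, probReal_univ, smul_eq_mul, mul_one] at key
  have : p * p = p ^ 2 := by ring
  linarith

end FiniteFeatures

/-! ### Hilbert–Schmidt bound, and distance to the span of almost orthogonal vectors. -/

lemma ennreal_sq_lintegral_mul_le {Y : Type*} [MeasurableSpace Y] {ν : Measure Y}
    {f g : Y → ENNReal} (hf : AEMeasurable f ν) (hg : AEMeasurable g ν) :
    (∫⁻ y, f y * g y ∂ν) ^ 2 ≤ (∫⁻ y, f y ^ 2 ∂ν) * ∫⁻ y, g y ^ 2 ∂ν := by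
  have h := ENNReal.lintegral_mul_le_Lp_mul_Lq ν Real.HolderConjugate.two_two hf hg
  simp only [Pi.mul_apply, ENNReal.rpow_two] at h
  calc (∫⁻ y, f y * g y ∂ν) ^ 2 ≤
      ((∫⁻ y, f y ^ 2 ∂ν) ^ (1 / 2 : ℝ) * (∫⁻ y, g y ^ 2 ∂ν) ^ (1 / 2 : ℝ)) ^ 2 := by gcongr
    _ = _ := by
      rw [mul_pow, ← ENNReal.rpow_two, ← ENNReal.rpow_two, ← ENNReal.rpow_mul, ← ENNReal.rpow_mul]
      norm_num

/-- The quadratic form of the second moment operator `∫ |K_x⟩⟨K_x| μ(dx)` is bounded by the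
Hilbert–Schmidt norm of that operator. -/
lemma sq_lintegral_sq_lintegral_mul_le {X : Type*} [MeasurableSpace X] {μ : Measure X} [SFinite μ]
    {K : X → X → ENNReal} (hK : Measurable (Function.uncurry K)) {F : X → ENNReal}
    (hF : Measurable F) (hA : ∫⁻ x, (∫⁻ z, F z * K x z ∂μ) ^ 2 ∂μ ≠ ⊤) :
    (∫⁻ x, (∫⁻ z, F z * K x z ∂μ) ^ 2 ∂μ) ^ 2 ≤
      (∫⁻ z, F z ^ 2 ∂μ) ^ 2 * ∫⁻ x, ∫⁻ x', (∫⁻ z, K x z * K x' z ∂μ) ^ 2 ∂μ ∂μ := by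
  set a : X → ENNReal := fun x => ∫⁻ z, F z * K x z ∂μ with ha
  have hFK : Measurable fun p : X × X => F p.2 * K p.1 p.2 := (hF.comp measurable_snd).mul hK
  have ham : Measurable a := hFK.lintegral_prod_right'
  set g : X → ENNReal := fun z => ∫⁻ x, a x * K x z ∂μ with hg
  have haK : Measurable fun p : X × X => a p.1 * K p.1 p.2 := (ham.comp measurable_fst).mul hK
  have hgm : Measurable g := haK.lintegral_prod_left'
  have hKK : Measurable fun q : (X × X) × X => K q.1.1 q.2 * K q.1.2 q.2 :=
    (hK.comp ((measurable_fst.comp measurable_fst).prodMk measurable_snd)).mul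
      (hK.comp ((measurable_snd.comp measurable_fst).prodMk measurable_snd))
  have hGm : Measurable fun p : X × X => ∫⁻ z, K p.1 z * K p.2 z ∂μ := hKK.lintegral_prod_right'
  have haa : Measurable fun p : X × X => a p.1 * a p.2 :=
    (ham.comp measurable_fst).mul (ham.comp measurable_snd)
  -- With T the integral operator of `K`, a = T F and g = T* a, so ‖a‖² = ⟨F, g⟩. Expanding ‖g‖²
  -- produces the Gram kernel of `K`, and Cauchy–Schwarz on the product space brings in its
  -- Hilbert–Schmidt norm.
  have h1 : ∫⁻ x, a x ^ 2 ∂μ = ∫⁻ z, F z * g z ∂μ := by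
    calc ∫⁻ x, a x ^ 2 ∂μ = ∫⁻ x, ∫⁻ z, F z * (a x * K x z) ∂μ ∂μ := by
          refine lintegral_congr fun x => ?_
          calc a x ^ 2 = a x * ∫⁻ z, F z * K x z ∂μ := sq (a x)
            _ = _ := by
              refine (lintegral_const_mul _ (hFK.comp measurable_prodMk_left)).symm.trans ?_
              exact lintegral_congr fun z => mul_left_comm (a x) (F z) (K x z)
      _ = ∫⁻ z, ∫⁻ x, F z * (a x * K x z) ∂μ ∂μ :=
          lintegral_lintegral_swap ((hF.comp measurable_snd).mul haK).aemeasurable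
      _ = _ := lintegral_congr fun z => lintegral_const_mul _ (haK.comp measurable_prodMk_right)
  have h2 : ∫⁻ z, g z ^ 2 ∂μ = ∫⁻ p, (a p.1 * a p.2) * ∫⁻ z, K p.1 z * K p.2 z ∂μ ∂(μ.prod μ) := by
    have e : ∀ z, g z ^ 2 = ∫⁻ p, (a p.1 * a p.2) * (K p.1 z * K p.2 z) ∂(μ.prod μ) := fun z => by
      have := lintegral_prod_mul (μ := μ) (ν := μ) (f := fun x => a x * K x z)
        (g := fun x => a x * K x z) (haK.comp measurable_prodMk_right).aemeasurable
        (haK.comp measurable_prodMk_right).aemeasurable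
      rw [sq, hg, ← this]
      exact lintegral_congr fun p => by ring
    simp only [e]
    have hm : Measurable (Function.uncurry fun (z : X) (p : X × X) =>
        (a p.1 * a p.2) * (K p.1 z * K p.2 z)) :=
      (haa.comp measurable_snd).mul (hKK.comp measurable_swap)
    rw [lintegral_lintegral_swap hm.aemeasurable]
    exact lintegral_congr fun p => lintegral_const_mul _ (hKK.comp measurable_prodMk_left)
  have h3 : (∫⁻ z, g z ^ 2 ∂μ) ^ 2 ≤ (∫⁻ x, a x ^ 2 ∂μ) ^ 2 *
      ∫⁻ x, ∫⁻ x', (∫⁻ z, K x z * K x' z ∂μ) ^ 2 ∂μ ∂μ := by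
    rw [h2]
    refine (ennreal_sq_lintegral_mul_le haa.aemeasurable hGm.aemeasurable).trans_eq ?_
    rw [lintegral_prod _ (hGm.pow_const 2).aemeasurable]
    congr 1
    simp only [mul_pow]
    rw [lintegral_prod_mul (ham.pow_const 2).aemeasurable (ham.pow_const 2).aemeasurable, sq]
  set A := ∫⁻ x, a x ^ 2 ∂μ
  set H := ∫⁻ x, ∫⁻ x', (∫⁻ z, K x z * K x' z ∂μ) ^ 2 ∂μ ∂μ
  have h4 : A ^ 2 ≤ (∫⁻ z, F z ^ 2 ∂μ) * ∫⁻ z, g z ^ 2 ∂μ := by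
    conv_lhs => rw [h1]
    exact ennreal_sq_lintegral_mul_le hF.aemeasurable hgm.aemeasurable
  have h5 : A ^ 2 * A ^ 2 ≤ A ^ 2 * ((∫⁻ z, F z ^ 2 ∂μ) ^ 2 * H) := by
    calc A ^ 2 * A ^ 2 = (A ^ 2) ^ 2 := by ring
      _ ≤ ((∫⁻ z, F z ^ 2 ∂μ) * ∫⁻ z, g z ^ 2 ∂μ) ^ 2 := by gcongr
      _ = (∫⁻ z, F z ^ 2 ∂μ) ^ 2 * (∫⁻ z, g z ^ 2 ∂μ) ^ 2 := by ring
      _ ≤ (∫⁻ z, F z ^ 2 ∂μ) ^ 2 * (A ^ 2 * H) := by gcongr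
      _ = _ := by ring
  -- Cancelling A² is where finiteness of A is needed.
  rcases eq_or_ne A 0 with h0 | h0
  · rw [h0]; simp
  · exact (ENNReal.mul_le_mul_iff_right (pow_ne_zero 2 h0) (ENNReal.pow_ne_top hA)).1 h5

/-- The hypothesis says that the off-diagonal part of the Gram matrix of the normalized vectors has
Hilbert–Schmidt norm at most 1/2. So the squared norm of a combination is at least half that of its
normalized coefficients β, and completing the square in β costs at most 2 ∑ c_i². Zero vectors are
harmless because division by zero gives 0. -/
lemma norm_sq_sub_le_norm_sub_sum_sq {E : Type*} [NormedAddCommGroup E] [InnerProductSpace ℝ E]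
    {n : ℕ} (v : Fin n → E) (f : E) (α : Fin n → ℝ)
    (h : ∑ i, ∑ j, (if i = j then 0 else
      inner ℝ (v i) (v j) ^ 2 / (‖v i‖ ^ 2 * ‖v j‖ ^ 2)) ≤ 1 / 4) :
    ‖f‖ ^ 2 - 2 * ∑ i, inner ℝ f (v i) ^ 2 / ‖v i‖ ^ 2 ≤ ‖∑ i, α i • v i - f‖ ^ 2 := by
  set β : Fin n → ℝ := fun i => α i * ‖v i‖ with hβ
  set c : Fin n → ℝ := fun i => inner ℝ f (v i) / ‖v i‖ with hc
  set G : Fin n → Fin n → ℝ := fun i j => inner ℝ (v i) (v j) / (‖v i‖ * ‖v j‖) with hG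
  have hcβ : inner ℝ (∑ i, α i • v i) f = ∑ i, β i * c i := by
    rw [sum_inner]
    refine Finset.sum_congr rfl fun i _ => ?_
    rw [real_inner_smul_left, real_inner_comm]
    by_cases hv : v i = 0
    · simp [hβ, hc, hv]
    · have : ‖v i‖ ≠ 0 := norm_ne_zero_iff.2 hv
      simp only [hβ, hc]; field_simp
  have hn : ‖∑ i, α i • v i‖ ^ 2 =
      ∑ i, β i ^ 2 + ∑ i, ∑ j, if i = j then 0 else β i * β j * G i j := by
    rw [← real_inner_self_eq_norm_sq, sum_inner, ← Finset.sum_add_distrib]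
    refine Finset.sum_congr rfl fun i _ => ?_
    have e : ∀ j, inner ℝ (α i • v i) (α j • v j) =
        (if i = j then β i ^ 2 else 0) + if i = j then 0 else β i * β j * G i j := fun j => by
      rw [real_inner_smul_left, real_inner_smul_right]
      by_cases hij : i = j
      · subst hij; simp [hβ, mul_pow]; ring
      · simp only [hij, if_false, zero_add]
        by_cases hv : v i = 0
        · simp [hβ, hv]
        by_cases hw : v j = 0
        · simp [hβ, hw]
        have h1 : ‖v i‖ ≠ 0 := norm_ne_zero_iff.2 hv
        have h2 : ‖v j‖ ≠ 0 := norm_ne_zero_iff.2 hw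
        simp only [hβ, hG]; field_simp
    rw [inner_sum]
    simp only [e, Finset.sum_add_distrib]
    simp
  set b := ∑ i, β i ^ 2 with hb
  have hb0 : 0 ≤ b := Finset.sum_nonneg fun i _ => sq_nonneg _
  set s := ∑ i, c i ^ 2 with hs
  have hs' : ∑ i, inner ℝ f (v i) ^ 2 / ‖v i‖ ^ 2 = s :=
    Finset.sum_congr rfl fun i _ => by simp only [hc, div_pow]
  have hoff : (∑ i, ∑ j, if i = j then 0 else β i * β j * G i j) ^ 2 ≤ b ^ 2 * (1 / 4) := by
    have h1 := Finset.sum_mul_sq_le_sq_mul_sq (Finset.univ : Finset (Fin n × Fin n))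
      (fun p => β p.1 * β p.2) (fun p => if p.1 = p.2 then 0 else G p.1 p.2)
    simp only [Fintype.sum_prod_type, mul_ite, mul_zero] at h1
    refine h1.trans ?_
    have h2 : ∑ i, ∑ j, (β i * β j) ^ 2 = b ^ 2 := by
      rw [hb, sq (∑ i, β i ^ 2), Finset.sum_mul_sum]
      simp only [mul_pow]
    rw [h2]
    refine mul_le_mul_of_nonneg_left (le_trans (le_of_eq ?_) h) (sq_nonneg _)
    refine Finset.sum_congr rfl fun i _ => Finset.sum_congr rfl fun j _ => ?_
    split_ifs
    · simp
    · simp only [hG, div_pow, mul_pow]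
  have hoff' := abs_le_of_sq_le_sq' (show _ ≤ (b / 2) ^ 2 by
    refine hoff.trans_eq ?_; ring) (by positivity)
  -- The weights in 2βc ≤ β²/2 + 2c² use up exactly the b / 2 left by the off-diagonal bound.
  have hcs : 2 * ∑ i, β i * c i ≤ b / 2 + 2 * s := by
    rw [hb, hs, Finset.mul_sum, Finset.mul_sum, Finset.sum_div, ← Finset.sum_add_distrib]
    exact Finset.sum_le_sum fun i _ => by nlinarith [sq_nonneg (β i - 2 * c i)]
  rw [norm_sub_sq_real, hcβ, hn, hs']
  linarith [hoff'.1]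

/-! ### From risk to L² distance. -/

/-- The risk dominates the squared `L²` distance from the regression function. -/
lemma ofReal_integral_sub_sq_le_risk {X : Type*} [MeasurableSpace X] {μ : Measure X}
    {f : X → ℝ} {D : Measure (X × ℝ)} [IsProbabilityMeasure D] (hD : IsRegressionLaw D μ f)
    (hf : MemLp f 2 μ) {h : X → ℝ} (hh : MemLp h 2 μ) :
    ENNReal.ofReal (∫ x, (h x - f x) ^ 2 ∂μ) ≤ risk D h := by
  by_cases htop : risk D h = ⊤
  · simp [htop]
  have hmp : MeasurePreserving (Prod.fst : X × ℝ → X) D μ := ⟨measurable_fst, hD.map_fst⟩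
  have hu : MemLp (fun p : X × ℝ => h p.1 - f p.1) 2 D :=
    (hh.sub hf).comp_measurePreserving hmp
  have hhD : MemLp (fun p : X × ℝ => h p.1) 2 D := hh.comp_measurePreserving hmp
  have hres : MemLp (fun p : X × ℝ => h p.1 - p.2) 2 D := by
    have hm : AEStronglyMeasurable (fun p : X × ℝ => h p.1 - p.2) D :=
      hhD.1.sub measurable_snd.aestronglyMeasurable
    rw [memLp_two_iff_integrable_sq hm]
    refine ⟨hm.pow 2, ?_⟩
    rw [hasFiniteIntegral_iff_ofReal (ae_of_all _ fun _ => sq_nonneg _)]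
    exact lt_top_iff_ne_top.2 htop
  -- The noise is only assumed integrable; finite risk makes it square integrable, as a difference
  -- of two L² functions. The cross term is then integrable and vanishes by conditioning on the
  -- input.
  have hξ : MemLp (fun p : X × ℝ => p.2 - f p.1) 2 D := by
    have := hu.sub hres
    refine this.congr_norm hD.integrable_noise.1 (ae_of_all _ fun p => ?_)
    simp
  have hcross : ∫ p, (h p.1 - f p.1) * (p.2 - f p.1) ∂D = 0 := by
    obtain ⟨g, hg, hge⟩ := (hh.sub hf).1
    have hae : (fun p : X × ℝ => h p.1 - f p.1) =ᵐ[D] fun p => g p.1 :=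
      hmp.quasiMeasurePreserving.ae_eq_comp hge
    have hsm : AEStronglyMeasurable[MeasurableSpace.comap (Prod.fst : X × ℝ → X) inferInstance]
        (fun p : X × ℝ => h p.1 - f p.1) D :=
      ⟨fun p => g p.1, hg.comp_measurable (comap_measurable _), hae⟩
    have hce := condExp_mul_of_aestronglyMeasurable_left hsm (hu.integrable_mul hξ)
      hD.integrable_noise
    rw [show (fun p : X × ℝ => (h p.1 - f p.1) * (p.2 - f p.1)) =
      (fun p : X × ℝ => h p.1 - f p.1) * fun p => p.2 - f p.1 from rfl]
    rw [← integral_condExp measurable_fst.comap_le]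
    rw [← integral_zero (X × ℝ) ℝ (μ := D)]
    refine integral_congr_ae ?_
    filter_upwards [hce, hD.condExp_noise] with p h1 h2
    rw [h1, Pi.mul_apply, h2]; simp
  have hrisk : risk D h = ENNReal.ofReal (∫ p, (h p.1 - p.2) ^ 2 ∂D) :=
    (ofReal_integral_eq_lintegral_ofReal hres.integrable_sq (ae_of_all _ fun _ => sq_nonneg _)).symm
  rw [hrisk]
  refine ENNReal.ofReal_le_ofReal ?_
  have h1 : ∫ x, (h x - f x) ^ 2 ∂μ = ∫ p, (h p.1 - f p.1) ^ 2 ∂D := by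
    rw [← hD.map_fst]
    refine integral_map measurable_fst.aemeasurable ?_
    rw [hD.map_fst]
    exact (hh.sub hf).1.pow 2
  have h2 : ∀ p : X × ℝ, (h p.1 - p.2) ^ 2 = (h p.1 - f p.1) ^ 2 + (p.2 - f p.1) ^ 2 -
      2 * ((h p.1 - f p.1) * (p.2 - f p.1)) := fun p => by ring
  simp only [h2]
  have hx : Integrable (fun p : X × ℝ => (h p.1 - f p.1) * (p.2 - f p.1)) D :=
    hu.integrable_mul hξ
  have hs : Integrable (fun p : X × ℝ => (h p.1 - f p.1) ^ 2 + (p.2 - f p.1) ^ 2) D :=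
    hu.integrable_sq.add hξ.integrable_sq
  rw [h1, integral_sub hs (hx.const_mul 2), integral_add hu.integrable_sq hξ.integrable_sq,
    integral_const_mul, hcross]
  have : 0 ≤ ∫ p : X × ℝ, (p.2 - f p.1) ^ 2 ∂D := integral_nonneg fun _ => sq_nonneg _
  linarith

/-! ### Laws of one and of two sample points. -/

section Marginals

variable {X : Type*} [MeasurableSpace X] {μ : Measure X}

lemma measurePreserving_fst_eval {D : Measure (X × ℝ)} [IsProbabilityMeasure D]
    (hD : D.map Prod.fst = μ) {n : ℕ} (i : Fin n) :
    MeasurePreserving (fun S : Fin n → X × ℝ => (S i).1) (Measure.pi fun _ : Fin n => D) μ :=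
  (MeasurePreserving.mk measurable_fst hD).comp (measurePreserving_eval (fun _ : Fin n => D) i)

lemma measurePreserving_fst_pair {D : Measure (X × ℝ)} [IsProbabilityMeasure D]
    (hD : D.map Prod.fst = μ) {n : ℕ} {i j : Fin n} (hij : i ≠ j) :
    MeasurePreserving (fun S : Fin n → X × ℝ => ((S i).1, (S j).1))
      (Measure.pi fun _ : Fin n => D) (μ.prod μ) := by
  have hm : ∀ i : Fin n, Measurable fun S : Fin n → X × ℝ => (S i).1 := fun i =>
    measurable_fst.comp (measurable_pi_apply i)
  refine ⟨(hm i).prodMk (hm j), ?_⟩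
  have hind := (ProbabilityTheory.iIndepFun_pi (μ := fun _ : Fin n => D)
    (X := fun (_ : Fin n) (p : X × ℝ) => p.1)
    fun _ => measurable_fst.aemeasurable).indepFun hij
  rw [(ProbabilityTheory.indepFun_iff_map_prod_eq_prod_map_map (hm i).aemeasurable
    (hm j).aemeasurable).1 hind]
  rw [(measurePreserving_fst_eval hD i).map_eq, (measurePreserving_fst_eval hD j).map_eq]

end Marginals

/-! ### Random samples: failure probability of kernel ridge regression. -/

section Sampling

variable {X : Type*} [MeasurableSpace X] {μ : Measure X} [IsProbabilityMeasure μ]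
  {k : X → X → ℝ}

lemma lintegral_lintegral_ofReal_of_mem_Icc {g : X → X → ℝ} (hg : Measurable (Function.uncurry g))
    (h0 : ∀ x z, 0 ≤ g x z) (h1 : ∀ x z, g x z ≤ 1) :
    ∫⁻ x, ∫⁻ z, ENNReal.ofReal (g x z) ∂μ ∂μ = ENNReal.ofReal (∫ x, ∫ z, g x z ∂μ ∂μ) := by
  rw [ofReal_integral_eq_lintegral_ofReal (integrable_integral_of_mem_Icc hg h0 h1)
    (ae_of_all _ fun x => integral_nonneg (h0 x))]
  refine lintegral_congr fun x => ?_
  exact (ofReal_integral_eq_lintegral_ofReal (f := g x)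
    (integrable_of_mem_Icc (hg.comp measurable_prodMk_left) (h0 x) (h1 x))
    (ae_of_all _ (h0 x))).symm

/-- The Hilbert–Schmidt bound is applied to |g| and the kernel functions normalized in L²(μ). Their
overlaps square to `cosSq`; since `k` is nonnegative, taking absolute values leaves these overlaps
unchanged. -/
lemma lintegral_sq_integral_mul_div_gram_le (hk : IsUnitKernel k) {g : X → ℝ}
    (hgm : Measurable g) (hg : MemLp g 2 μ) :
    ∫⁻ x, ENNReal.ofReal ((∫ z, g z * k x z ∂μ) ^ 2 / gram μ k x x) ∂μ ≤
      ENNReal.ofReal ((∫ z, g z ^ 2 ∂μ) * √(∫ x, ∫ z, cosSq μ k x z ∂μ ∂μ)) := by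
  set K : X → X → ENNReal := fun x z => ‖k x z / √(gram μ k x x)‖ₑ with hKdef
  set F : X → ENNReal := fun z => ‖g z‖ₑ with hFdef
  have hg0 := fun x => (gram_mem_Icc (μ := μ) hk x x).1
  have hK : Measurable (Function.uncurry K) :=
    (hk.measurable.div (((measurable_gram_self hk.measurable).comp measurable_fst).sqrt)).enorm
  have hF : Measurable F := hgm.enorm
  set N := ∫ z, g z ^ 2 ∂μ with hN
  have hN0 : 0 ≤ N := integral_nonneg fun _ => sq_nonneg _
  have esq : ∀ r : ℝ, ‖r‖ₑ ^ 2 = ENNReal.ofReal (r ^ 2) := fun r => by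
    rw [Real.enorm_eq_ofReal_abs, ← ENNReal.ofReal_pow (abs_nonneg r), sq_abs]
  have hF2 : ∫⁻ z, F z ^ 2 ∂μ = ENNReal.ofReal N := by
    rw [hN, ofReal_integral_eq_lintegral_ofReal hg.integrable_sq (ae_of_all _ fun _ => sq_nonneg _)]
    exact lintegral_congr fun z => esq _
  have hKK : ∀ x x', ∫⁻ z, K x z * K x' z ∂μ =
      ENNReal.ofReal (gram μ k x x' / (√(gram μ k x x) * √(gram μ k x' x'))) := fun x x' => by
    have hi : Integrable (fun z => k x z * k x' z / (√(gram μ k x x) * √(gram μ k x' x'))) μ :=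
      ((hk.memLp x).integrable_mul (hk.memLp x')).div_const _
    rw [gram, ← integral_div, ofReal_integral_eq_lintegral_ofReal hi
      (ae_of_all _ fun z => div_nonneg (mul_nonneg (hk.nonneg x z) (hk.nonneg x' z))
        (by positivity))]
    refine lintegral_congr fun z => ?_
    rw [hKdef]
    dsimp only
    rw [← enorm_mul, Real.enorm_eq_ofReal_abs, abs_of_nonneg, div_mul_div_comm]
    exact mul_nonneg (div_nonneg (hk.nonneg x z) (Real.sqrt_nonneg _))
      (div_nonneg (hk.nonneg x' z) (Real.sqrt_nonneg _))
  have hH : ∫⁻ x, ∫⁻ x', (∫⁻ z, K x z * K x' z ∂μ) ^ 2 ∂μ ∂μ =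
      ENNReal.ofReal (∫ x, ∫ z, cosSq μ k x z ∂μ ∂μ) := by
    rw [← lintegral_lintegral_ofReal_of_mem_Icc (measurable_cosSq hk.measurable)
      (cosSq_nonneg hk) (cosSq_le_one hk)]
    refine lintegral_congr fun x => lintegral_congr fun x' => ?_
    rw [hKK, ← ENNReal.ofReal_pow (div_nonneg (gram_mem_Icc hk x x').1 (by positivity)), div_pow,
      mul_pow, Real.sq_sqrt (hg0 x), Real.sq_sqrt (hg0 x')]
    rfl
  have hK1 : ∀ x, ∫⁻ z, K x z ^ 2 ∂μ ≤ 1 := fun x => by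
    simp only [sq]
    rw [hKK, Real.mul_self_sqrt (hg0 x), ← ENNReal.ofReal_one]
    exact ENNReal.ofReal_le_ofReal (div_self_le_one _)
  have hA : ∫⁻ x, (∫⁻ z, F z * K x z ∂μ) ^ 2 ∂μ ≠ ⊤ := by
    refine ne_top_of_le_ne_top (ENNReal.ofReal_ne_top (r := N)) ?_
    calc ∫⁻ x, (∫⁻ z, F z * K x z ∂μ) ^ 2 ∂μ ≤ ∫⁻ _, ENNReal.ofReal N ∂μ := by
          refine lintegral_mono fun x => ?_
          refine (ennreal_sq_lintegral_mul_le hF.aemeasurable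
            (hK.comp measurable_prodMk_left).aemeasurable).trans ?_
          rw [hF2]
          exact mul_le_of_le_one_right' (hK1 x)
      _ = _ := by simp
  have hmain := sq_lintegral_sq_lintegral_mul_le hK hF hA
  have hcc : 0 ≤ ∫ x, ∫ z, cosSq μ k x z ∂μ ∂μ :=
    integral_nonneg fun x => integral_nonneg fun z => cosSq_nonneg hk x z
  rw [hF2, hH, ← Real.sq_sqrt hcc, ENNReal.ofReal_pow (Real.sqrt_nonneg _), ← mul_pow,
    ← ENNReal.ofReal_mul hN0] at hmain
  refine le_trans (lintegral_mono fun x => ?_) ((ENNReal.pow_le_pow_left_iff two_ne_zero).1 hmain)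
  calc ENNReal.ofReal ((∫ z, g z * k x z ∂μ) ^ 2 / gram μ k x x)
      = ‖∫ z, g z * (k x z / √(gram μ k x x)) ∂μ‖ₑ ^ 2 := by
        rw [esq]
        simp only [← mul_div_assoc]
        rw [integral_div, div_pow, Real.sq_sqrt (hg0 x)]
    _ ≤ (∫⁻ z, F z * K x z ∂μ) ^ 2 := by
        gcongr
        refine (enorm_integral_le_lintegral_enorm _).trans_eq ?_
        exact lintegral_congr fun z => enorm_mul _ _

/-- Strict diagonal dominance: the diagonal entries are 1 + t ≥ 1, and all off-diagonal entries
together sum to less than 1. -/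
lemma isUnit_ridgeMatrix (hk : IsUnitKernel k) {n : ℕ} {S : Fin n → X × ℝ}
    (hS : ∑ i, ∑ j, (if i = j then 0 else k (S i).1 (S j).1) < 1) {t : ℝ} (ht : 0 ≤ t) :
    IsUnit (ridgeMatrix k S t) := by
  rw [Matrix.isUnit_iff_isUnit_det, isUnit_iff_ne_zero]
  refine det_ne_zero_of_sum_row_lt_diag fun i => ?_
  have h1 : ridgeMatrix k S t i i = 1 + t := by simp [ridgeMatrix, hk.diag]
  have h2 : ∑ j ∈ Finset.univ.erase i, ‖ridgeMatrix k S t i j‖ =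
      ∑ j, if i = j then 0 else k (S i).1 (S j).1 := by
    rw [← Finset.sum_erase (s := Finset.univ) (a := i)
      (f := fun j => if i = j then 0 else k (S i).1 (S j).1) (by simp)]
    refine Finset.sum_congr rfl fun j hj => ?_
    have hij : i ≠ j := (Finset.ne_of_mem_erase hj).symm
    simp [ridgeMatrix, hij, abs_of_nonneg (hk.nonneg _ _)]
  rw [h1, h2, Real.norm_of_nonneg (by linarith)]
  have h3 := Finset.single_le_sum
    (f := fun i => ∑ j, if i = j then 0 else k (S i).1 (S j).1)
    (fun i _ => Finset.sum_nonneg fun j _ => by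
      split_ifs
      · exact le_rfl
      · exact hk.nonneg _ _) (Finset.mem_univ i)
  linarith

lemma le_risk_krr (hk : IsUnitKernel k) {f : X → ℝ} (hf : MemLp f 2 μ) {D : Measure (X × ℝ)}
    [IsProbabilityMeasure D] (hD : IsRegressionLaw D μ f) {n : ℕ} {S : Fin n → X × ℝ}
    (hS : ∑ i, ∑ j, (if i = j then 0 else cosSq μ k (S i).1 (S j).1) ≤ 1 / 4) (t : ℝ) :
    ENNReal.ofReal (∫ x, f x ^ 2 ∂μ -
      2 * ∑ i, (∫ z, f z * k (S i).1 z ∂μ) ^ 2 / gram μ k (S i).1 (S i).1) ≤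
      risk D (krr k S t) := by
  set α := Matrix.mulVec (ridgeMatrix k S t)⁻¹ fun j => (S j).2 with hα
  have hkm := fun i => hk.memLp (μ := μ) (S i).1
  set v : Fin n → Lp ℝ 2 μ := fun i => (hkm i).toLp _ with hv
  have hn : ∀ i, ‖v i‖ ^ 2 = gram μ k (S i).1 (S i).1 := fun i => by
    rw [hv, norm_toLp_sq_eq_integral, gram]; simp only [sq]
  have hin : ∀ i j, inner ℝ (v i) (v j) = gram μ k (S i).1 (S j).1 := fun i j =>
    inner_toLp_eq_integral _ _
  have hinf : ∀ i, inner ℝ (hf.toLp f) (v i) = ∫ z, f z * k (S i).1 z ∂μ := fun i =>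
    inner_toLp_eq_integral _ _
  have hmain := norm_sq_sub_le_norm_sub_sum_sq v (hf.toLp f) α (by
    simp only [hn, hin]
    exact hS)
  simp only [hn, hinf] at hmain
  rw [norm_toLp_sq_eq_integral] at hmain
  have hkrr : krr k S t = ∑ i, α i • k (S i).1 := by
    ext x; simp [krr, hα]
  have hh : MemLp (∑ i, α i • k (S i).1) 2 μ := memLp_finsetSum' _ fun i _ => (hkm i).const_smul _
  have hsum : ∑ i, α i • v i = hh.toLp _ := by
    refine Lp.ext ?_
    have e1 : ∀ s : Finset (Fin n), ((∑ i ∈ s, α i • v i : Lp ℝ 2 μ) : X → ℝ) =ᵐ[μ]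
        ∑ i ∈ s, α i • k (S i).1 := by
      intro s
      induction s using Finset.induction_on with
      | empty => simpa only [Finset.sum_empty] using Lp.coeFn_zero ℝ 2 μ
      | insert a s ha ih =>
        rw [Finset.sum_insert ha, Finset.sum_insert ha]
        refine (Lp.coeFn_add _ _).trans (Filter.EventuallyEq.add ?_ ih)
        refine (Lp.coeFn_smul _ _).trans ?_
        filter_upwards [(hkm a).coeFn_toLp] with x hx
        simp [hv, hx]
    exact (e1 Finset.univ).trans hh.coeFn_toLp.symm
  rw [hsum, ← MemLp.toLp_sub hh hf, norm_toLp_sq_eq_integral] at hmain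
  rw [hkrr]
  exact (ENNReal.ofReal_le_ofReal hmain).trans (ofReal_integral_sub_sq_le_risk hD hf hh)

/-- If kernel values at independent points are small in mean and kernel functions at independent
points are almost orthogonal in mean, then kernel ridge regression does not learn. -/
theorem measure_not_le_risk_krr_le (hk : IsUnitKernel k) {f : X → ℝ} (hf : MemLp f 2 μ)
    {D : Measure (X × ℝ)} [IsProbabilityMeasure D] (hD : IsRegressionLaw D μ f) (n : ℕ)
    {ε η : ℝ} (hε : 0 < ε) (hη : 0 ≤ η) (hη1 : η ≤ 1)
    (h1 : ∫ x, ∫ z, k x z ∂μ ∂μ ≤ η) (h2 : ∫ x, ∫ z, cosSq μ k x z ∂μ ∂μ ≤ η ^ 2) :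
    (Measure.pi fun _ : Fin n => D)
      {S | ¬ ∀ t : ℝ, 0 ≤ t → IsUnit (ridgeMatrix k S t) ∧
        ENNReal.ofReal ((1 - ε) * ∫ x, f x ^ 2 ∂μ) ≤ risk D (krr k S t)} ≤
      ENNReal.ofReal ((n : ℝ) ^ 2 * ((5 + 2 / ε) * η)) := by
  set N := ∫ x, f x ^ 2 ∂μ with hN
  have hN0 : 0 ≤ N := integral_nonneg fun _ => sq_nonneg _
  -- A measurable representative of `f`, for the measurability of the Markov variable below.
  set g := hf.1.mk f with hg
  have hfg : f =ᵐ[μ] g := hf.1.ae_eq_mk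
  have hgm : Measurable g := hf.1.stronglyMeasurable_mk.measurable
  have hgL : MemLp g 2 μ := hf.ae_eq hfg
  have hgN : ∫ x, g x ^ 2 ∂μ = N := integral_congr_ae (hfg.mono fun x hx => by simp only [hx])
  -- The weights 1, 4 and 2 / (εN) are scaled so that a total below 1 forces all three conditions:
  -- diagonal dominance, squared cosines summing to at most 1/4, and captured energy at most εN.
  set w : X × X → ENNReal := fun p =>
    ENNReal.ofReal (k p.1 p.2) + 4 * ENNReal.ofReal (cosSq μ k p.1 p.2) with hw
  set q : X → ℝ := fun x => (∫ z, g z * k x z ∂μ) ^ 2 / gram μ k x x with hq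
  have hq0 : ∀ x, 0 ≤ q x := fun x => div_nonneg (sq_nonneg _) (gram_mem_Icc hk x x).1
  set u : X → ENNReal := fun x => ENNReal.ofReal (2 / (ε * N)) * ENNReal.ofReal (q x) with hu
  have hwm : Measurable w := hk.measurable.ennreal_ofReal.add
    ((measurable_cosSq hk.measurable).ennreal_ofReal.const_mul _)
  have hqm : Measurable q := by
    have : Measurable fun p : X × X => g p.2 * k p.1 p.2 :=
      (hgm.comp measurable_snd).mul hk.measurable
    exact (this.stronglyMeasurable.integral_prod_right.measurable.pow_const 2).div
      (measurable_gram_self hk.measurable)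
  have hum : Measurable u := hqm.ennreal_ofReal.const_mul _
  have hwint : ∫⁻ p, w p ∂(μ.prod μ) ≤ ENNReal.ofReal (5 * η) := by
    rw [lintegral_prod _ hwm.aemeasurable]
    have hcm := (measurable_cosSq (μ := μ) hk.measurable)
    have e : ∀ x, ∫⁻ z, w (x, z) ∂μ = (∫⁻ z, ENNReal.ofReal (k x z) ∂μ) +
        4 * ∫⁻ z, ENNReal.ofReal (cosSq μ k x z) ∂μ := fun x => by
      have hx : Measurable fun z => ENNReal.ofReal (cosSq μ k x z) :=
        (hcm.comp measurable_prodMk_left).ennreal_ofReal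
      rw [← lintegral_const_mul _ hx]
      exact lintegral_add_left (hk.measurable.comp measurable_prodMk_left).ennreal_ofReal _
    simp only [e]
    have hkm : Measurable fun x => ∫⁻ z, ENNReal.ofReal (k x z) ∂μ :=
      hk.measurable.ennreal_ofReal.lintegral_prod_right'
    rw [lintegral_add_left hkm,
      lintegral_const_mul _ hcm.ennreal_ofReal.lintegral_prod_right',
      lintegral_lintegral_ofReal_of_mem_Icc hk.measurable hk.nonneg hk.le_one,
      lintegral_lintegral_ofReal_of_mem_Icc hcm (cosSq_nonneg hk) (cosSq_le_one hk),
      show (5 : ℝ) * η = η + 4 * η by ring, ENNReal.ofReal_add hη (by positivity),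
      ENNReal.ofReal_mul (by norm_num)]
    gcongr
    · simp
    -- Here η² ≤ η suffices; the full strength η² is needed for `u`, where a square root is taken.
    · exact h2.trans (by nlinarith)
  have huint : ∫⁻ x, u x ∂μ ≤ ENNReal.ofReal (2 / ε * η) := by
    rw [lintegral_const_mul _ hqm.ennreal_ofReal]
    calc ENNReal.ofReal (2 / (ε * N)) * ∫⁻ x, ENNReal.ofReal (q x) ∂μ
        ≤ ENNReal.ofReal (2 / (ε * N)) * ENNReal.ofReal (N * η) := by
          gcongr
          refine (lintegral_sq_integral_mul_div_gram_le hk hgm hgL).trans ?_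
          rw [hgN]
          refine ENNReal.ofReal_le_ofReal (mul_le_mul_of_nonneg_left ?_ hN0)
          exact Real.sqrt_le_iff.2 ⟨hη, h2⟩
      _ = ENNReal.ofReal (2 / (ε * N) * (N * η)) := (ENNReal.ofReal_mul (by positivity)).symm
      _ ≤ _ := by
        refine ENNReal.ofReal_le_ofReal ?_
        rcases hN0.eq_or_lt with h | h
        · rw [← h]; simp; positivity
        · exact le_of_eq (by field_simp)
  set Z : (Fin n → X × ℝ) → ENNReal := fun S =>
    (∑ i, ∑ j, if i = j then 0 else w ((S i).1, (S j).1)) + ∑ i, u (S i).1 with hZ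
  have hm1 : ∀ i : Fin n, Measurable fun S : Fin n → X × ℝ => (S i).1 := fun i =>
    measurable_fst.comp (measurable_pi_apply i)
  have hwm' : ∀ i j : Fin n, Measurable fun S : Fin n → X × ℝ =>
      if i = j then (0 : ENNReal) else w ((S i).1, (S j).1) := fun i j => by
    split_ifs
    · exact measurable_const
    · exact hwm.comp ((hm1 i).prodMk (hm1 j))
  have hum' : ∀ i : Fin n, Measurable fun S : Fin n → X × ℝ => u (S i).1 := fun i =>
    hum.comp (hm1 i)
  have hs1 : Measurable fun S : Fin n → X × ℝ =>
      ∑ i, ∑ j, if i = j then (0 : ENNReal) else w ((S i).1, (S j).1) :=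
    Finset.measurable_fun_sum _ fun i _ => Finset.measurable_fun_sum _ fun j _ => hwm' i j
  have hZm : Measurable Z := hs1.add (Finset.measurable_fun_sum _ fun i _ => hum' i)
  have hZint : ∫⁻ S, Z S ∂(Measure.pi fun _ : Fin n => D) ≤
      ENNReal.ofReal ((n : ℝ) ^ 2 * ((5 + 2 / ε) * η)) := by
    rw [hZ, lintegral_add_left hs1,
      lintegral_finsetSum _ fun i _ => Finset.measurable_fun_sum _ fun j _ => hwm' i j,
      lintegral_finsetSum _ fun i _ => hum' i]
    have b1 : ∀ i j : Fin n, ∫⁻ S : Fin n → X × ℝ, (if i = j then 0 else w ((S i).1, (S j).1))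
        ∂(Measure.pi fun _ : Fin n => D) ≤ ENNReal.ofReal (5 * η) := fun i j => by
      split_ifs with hij
      · simp
      · rw [(measurePreserving_fst_pair hD.map_fst hij).lintegral_comp hwm]
        exact hwint
    have b2 : ∀ i : Fin n, ∫⁻ S : Fin n → X × ℝ, u (S i).1 ∂(Measure.pi fun _ : Fin n => D) ≤
        ENNReal.ofReal (2 / ε * η) := fun i => by
      rw [(measurePreserving_fst_eval hD.map_fst i).lintegral_comp hum]
      exact huint
    have hn : (n : ℝ) ≤ (n : ℝ) ^ 2 := by
      exact_mod_cast Nat.le_self_pow two_ne_zero n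
    calc _ ≤ ∑ _i : Fin n, ∑ _j : Fin n, ENNReal.ofReal (5 * η) +
          ∑ _i : Fin n, ENNReal.ofReal (2 / ε * η) := by
          refine add_le_add (Finset.sum_le_sum fun i _ => ?_) (Finset.sum_le_sum fun i _ => ?_)
          · rw [lintegral_finsetSum _ fun j _ => hwm' i j]
            exact Finset.sum_le_sum fun j _ => b1 i j
          · exact b2 i
      _ = ENNReal.ofReal ((n : ℝ) ^ 2 * (5 * η) + n * (2 / ε * η)) := by
          rw [ENNReal.ofReal_add (by positivity) (by positivity),
            ENNReal.ofReal_mul (p := (n : ℝ) ^ 2) (by positivity),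
            ENNReal.ofReal_mul (p := (n : ℝ)) (by positivity),
            ENNReal.ofReal_pow (by positivity), ENNReal.ofReal_natCast]
          simp [sq, mul_assoc]
      _ ≤ _ := by
          refine ENNReal.ofReal_le_ofReal ?_
          have : (n : ℝ) * (2 / ε * η) ≤ (n : ℝ) ^ 2 * (2 / ε * η) := by gcongr
          linarith
  refine le_trans (measure_mono ?_)
    ((one_mul ((Measure.pi fun _ : Fin n => D) {S | 1 ≤ Z S})).symm.le.trans
      ((mul_meas_ge_le_lintegral₀ hZm.aemeasurable 1).trans hZint))
  intro S hS
  by_contra hZS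
  refine hS ?_
  simp only [Set.mem_ofPred_eq, not_le] at hZS
  have e1 : ∑ i, ∑ j, (if i = j then (0 : ENNReal) else w ((S i).1, (S j).1)) = ENNReal.ofReal
      (∑ i, ∑ j, (if i = j then 0 else k (S i).1 (S j).1) +
        4 * ∑ i, ∑ j, (if i = j then 0 else cosSq μ k (S i).1 (S j).1)) := by
    simp only [Finset.mul_sum, ← Finset.sum_add_distrib]
    have hnn : ∀ i j : Fin n, 0 ≤ (if i = j then 0 else k (S i).1 (S j).1) +
        4 * (if i = j then 0 else cosSq μ k (S i).1 (S j).1) := fun i j => by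
      split_ifs
      · simp
      · have := hk.nonneg (S i).1 (S j).1
        have := cosSq_nonneg (μ := μ) hk (S i).1 (S j).1
        positivity
    rw [ENNReal.ofReal_sum_of_nonneg fun i _ => Finset.sum_nonneg fun j _ => hnn i j]
    refine Finset.sum_congr rfl fun i _ => ?_
    rw [ENNReal.ofReal_sum_of_nonneg fun j _ => hnn i j]
    refine Finset.sum_congr rfl fun j _ => ?_
    split_ifs
    · simp
    · rw [ENNReal.ofReal_add (hk.nonneg _ _)
        (mul_nonneg (by norm_num) (cosSq_nonneg hk _ _)), ENNReal.ofReal_mul (by norm_num)]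
      simp [hw]
  have e2 : ∑ i, u (S i).1 = ENNReal.ofReal (2 / (ε * N) * ∑ i, q (S i).1) := by
    rw [ENNReal.ofReal_mul (by positivity), ENNReal.ofReal_sum_of_nonneg fun i _ => hq0 _,
      Finset.mul_sum]
  have hk0 : 0 ≤ ∑ i, ∑ j, (if i = j then 0 else k (S i).1 (S j).1) :=
    Finset.sum_nonneg fun i _ => Finset.sum_nonneg fun j _ => by
      split_ifs
      exacts [le_rfl, hk.nonneg _ _]
  have hc0 : 0 ≤ ∑ i, ∑ j, (if i = j then 0 else cosSq μ k (S i).1 (S j).1) :=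
    Finset.sum_nonneg fun i _ => Finset.sum_nonneg fun j _ => by
      split_ifs
      exacts [le_rfl, cosSq_nonneg hk _ _]
  have hqs : 0 ≤ ∑ i, q (S i).1 := Finset.sum_nonneg fun i _ => hq0 _
  have hlt : (∑ i, ∑ j, (if i = j then 0 else k (S i).1 (S j).1) +
        4 * ∑ i, ∑ j, (if i = j then 0 else cosSq μ k (S i).1 (S j).1)) +
        2 / (ε * N) * ∑ i, q (S i).1 < 1 := by
    rw [hZ] at hZS
    dsimp only at hZS
    rw [e1, e2, ← ENNReal.ofReal_add (by positivity) (by positivity)] at hZS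
    exact ENNReal.ofReal_lt_one.1 hZS
  have hq' : 0 ≤ 2 / (ε * N) * ∑ i, q (S i).1 := by positivity
  intro t ht
  refine ⟨isUnit_ridgeMatrix hk (by linarith) ht, ?_⟩
  refine le_trans (ENNReal.ofReal_le_ofReal ?_) (le_risk_krr hk hf hD (by linarith) t)
  have hqf : ∀ i, (∫ z, f z * k (S i).1 z ∂μ) ^ 2 / gram μ k (S i).1 (S i).1 = q (S i).1 := by
    intro i
    have : ∫ z, f z * k (S i).1 z ∂μ = ∫ z, g z * k (S i).1 z ∂μ :=
      integral_congr_ae (hfg.mono fun z hz => by simp only [hz])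
    rw [this]
  simp only [hqf]
  -- If N = 0 the weight 2 / (εN) is 0 and carries no information, but then every `q` vanishes by
  -- Cauchy–Schwarz.
  rcases hN0.eq_or_lt with h | h
  · have hz : ∀ i, q (S i).1 = 0 := fun i => by
      have := sq_integral_mul_le hgL (hk.memLp (S i).1)
      rw [hgN, ← h, zero_mul] at this
      simp only [hq]
      rw [le_antisymm this (sq_nonneg _), zero_div]
    simp only [hz]
    rw [← hN, ← h]; simp
  · have h3 : 2 / (ε * N) * ∑ i, q (S i).1 ≤ 1 := by linarith
    rw [div_mul_eq_mul_div, div_le_one (by positivity)] at h3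
    linarith

end Sampling

/-! ### One qubit: real features, and purity as the mean kernel value. -/

/-- The one-qubit quantum kernel of an embedding. -/
def qubitKernel (φ : ℝ → Fin 2 → ℂ) (x z : ℝ) : ℝ :=
  ‖∑ b, star (φ x b) * φ z b‖ ^ 2

/-- Real coordinates of the density matrix of an embedded point, in which the Hilbert–Schmidt inner
product of Hermitian matrices is the dot product. -/
def qubitFeature (φ : ℝ → Fin 2 → ℂ) (p : Fin 2 × Fin 2) (x : ℝ) : ℝ :=
  (density (φ x) p.1 p.2).re + (density (φ x) p.1 p.2).im

/-- Real parts of Hermitian matrices are symmetric and imaginary parts antisymmetric, so the mixed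
terms cancel in the sum over entries. -/
lemma qubitKernel_eq_sum (φ : ℝ → Fin 2 → ℂ) (x z : ℝ) :
    qubitKernel φ x z = ∑ p, qubitFeature φ p x * qubitFeature φ p z := by
  simp only [qubitKernel, qubitFeature, density, Fintype.sum_prod_type, Fin.sum_univ_two,
    Matrix.vecMulVec_apply, ← Complex.normSq_eq_norm_sq, Complex.normSq_apply, Pi.star_apply,
    Complex.add_re, Complex.add_im, Complex.mul_re, Complex.mul_im, RCLike.star_def,
    Complex.conj_re, Complex.conj_im]
  ring

section Embedding

variable {φ : ℝ → Fin 2 → ℂ}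

lemma IsQubitEmbedding.measurable_apply (hφ : IsQubitEmbedding φ) (b : Fin 2) :
    Measurable fun x => φ x b :=
  (measurable_pi_apply b).comp hφ.measurable

lemma IsQubitEmbedding.measurable_density (hφ : IsQubitEmbedding φ) (a b : Fin 2) :
    Measurable fun x => density (φ x) a b :=
  (hφ.measurable_apply a).mul (Complex.continuous_conj.measurable.comp (hφ.measurable_apply b))

lemma IsQubitEmbedding.norm_apply_le_one (hφ : IsQubitEmbedding φ) (x : ℝ) (b : Fin 2) :
    ‖φ x b‖ ≤ 1 := by
  rw [← sq_le_one_iff₀ (norm_nonneg _), ← hφ.normalized x]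
  exact Finset.single_le_sum (f := fun b => ‖φ x b‖ ^ 2) (fun _ _ => sq_nonneg _)
    (Finset.mem_univ b)

lemma IsQubitEmbedding.integrable_density (hφ : IsQubitEmbedding φ) (ν : Measure ℝ)
    [IsFiniteMeasure ν] (a b : Fin 2) : Integrable (fun x => density (φ x) a b) ν := by
  refine Integrable.of_bound (hφ.measurable_density a b).aestronglyMeasurable 1
    (ae_of_all _ fun x => ?_)
  rw [density, Matrix.vecMulVec_apply, Pi.star_apply, norm_mul, norm_star]
  exact mul_le_one₀ (hφ.norm_apply_le_one x a) (norm_nonneg _) (hφ.norm_apply_le_one x b)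

lemma IsQubitEmbedding.measurable_qubitFeature (hφ : IsQubitEmbedding φ) (p : Fin 2 × Fin 2) :
    Measurable (qubitFeature φ p) :=
  (Complex.measurable_re.comp (hφ.measurable_density _ _)).add
    (Complex.measurable_im.comp (hφ.measurable_density _ _))

lemma IsQubitEmbedding.isUnitKernel (hφ : IsQubitEmbedding φ) :
    IsUnitKernel (qubitKernel φ) where
  measurable := by
    have : Function.uncurry (qubitKernel φ) =
        fun p : ℝ × ℝ => ∑ a, qubitFeature φ a p.1 * qubitFeature φ a p.2 := by
      ext p; exact qubitKernel_eq_sum φ p.1 p.2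
    rw [this]
    exact Finset.measurable_fun_sum _ fun a _ =>
      ((hφ.measurable_qubitFeature a).comp measurable_fst).mul
        ((hφ.measurable_qubitFeature a).comp measurable_snd)
  nonneg _ _ := sq_nonneg _
  le_one x z := by
    refine pow_le_one₀ (norm_nonneg _) ?_
    calc ‖∑ b, star (φ x b) * φ z b‖ ≤ ∑ b, ‖φ x b‖ * ‖φ z b‖ :=
          (norm_sum_le _ _).trans_eq (by simp only [norm_mul, norm_star])
      _ ≤ ∑ b, (‖φ x b‖ ^ 2 / 2 + ‖φ z b‖ ^ 2 / 2) := by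
          refine Finset.sum_le_sum fun b _ => ?_
          nlinarith [sq_nonneg (‖φ x b‖ - ‖φ z b‖)]
      _ = 1 := by
          rw [Finset.sum_add_distrib, ← Finset.sum_div, ← Finset.sum_div, hφ.normalized,
            hφ.normalized]
          norm_num
  diag x := by
    have : ∑ b, star (φ x b) * φ x b = ((∑ b, ‖φ x b‖ ^ 2 : ℝ) : ℂ) := by
      push_cast
      refine Finset.sum_congr rfl fun b _ => ?_
      rw [RCLike.star_def, Complex.conj_mul']
    rw [qubitKernel, this, hφ.normalized]
    simp

/-- By bilinearity both sides are the squared length of the mean feature vector. -/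
lemma IsQubitEmbedding.integral_integral_qubitKernel (hφ : IsQubitEmbedding φ) (ν : Measure ℝ)
    [IsProbabilityMeasure ν] :
    ∫ x, ∫ z, qubitKernel φ x z ∂ν ∂ν = purity (meanDensity φ ν) := by
  set m := meanDensity φ ν with hm
  have hre : ∀ a b, ∫ x, (density (φ x) a b).re ∂ν = (m a b).re := fun a b =>
    integral_re (hφ.integrable_density ν a b)
  have him : ∀ a b, ∫ x, (density (φ x) a b).im ∂ν = (m a b).im := fun a b =>
    integral_im (hφ.integrable_density ν a b)
  have hstar : ∀ a b, m b a = star (m a b) := fun a b => by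
    simp only [hm, meanDensity, Matrix.of_apply, RCLike.star_def]
    rw [← integral_conj]
    refine integral_congr_ae (ae_of_all _ fun x => ?_)
    simp [density, Matrix.vecMulVec_apply, mul_comm]
  have hri : ∀ a b, Integrable (fun x => (density (φ x) a b).re) ν := fun a b =>
    (hφ.integrable_density ν a b).re
  have hii : ∀ a b, Integrable (fun x => (density (φ x) a b).im) ν := fun a b =>
    (hφ.integrable_density ν a b).im
  have hfi : ∀ p, Integrable (qubitFeature φ p) ν := fun p => (hri _ _).add (hii _ _)
  have hf : ∀ p, ∫ x, qubitFeature φ p x ∂ν = (m p.1 p.2).re + (m p.1 p.2).im := fun p => by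
    rw [← hre, ← him, ← integral_add (hri _ _) (hii _ _)]
    rfl
  have h1 : ∫ x, ∫ z, qubitKernel φ x z ∂ν ∂ν = ∑ p : Fin 2 × Fin 2,
      ((m p.1 p.2).re + (m p.1 p.2).im) * ((m p.1 p.2).re + (m p.1 p.2).im) := by
    simp only [qubitKernel_eq_sum]
    have e : ∀ x, ∫ z, ∑ p, qubitFeature φ p x * qubitFeature φ p z ∂ν =
        ∑ p : Fin 2 × Fin 2, qubitFeature φ p x * ((m p.1 p.2).re + (m p.1 p.2).im) := fun x => by
      rw [integral_finsetSum _ fun p _ => (hfi p).const_mul _]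
      exact Finset.sum_congr rfl fun p _ => by rw [integral_const_mul, hf]
    simp only [e]
    rw [integral_finsetSum _ fun p _ => (hfi p).mul_const _]
    exact Finset.sum_congr rfl fun p _ => by rw [integral_mul_const, hf]
  have h0 : ∀ a, (m a a).im = 0 := fun a => by
    have := congrArg Complex.im (hstar a a)
    simp only [RCLike.star_def, Complex.conj_im] at this
    linarith
  rw [h1]
  simp only [purity, Matrix.trace, Matrix.diag, Matrix.mul_apply, Fintype.sum_prod_type,
    Fin.sum_univ_two, Complex.add_re, Complex.mul_re, h0, hstar 0 1, RCLike.star_def,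
    Complex.conj_re, Complex.conj_im]
  ring

end Embedding

/-! ### Tensor products: factorization over the qubits. -/

section Product

variable {d : ℕ}

/-- The trace is the squared modulus of an inner product, which is invariant under `V` and
factorizes on product vectors. -/
lemma kernel_eq_prod_qubitKernel (φ : Fin d → ℝ → Fin 2 → ℂ)
    (V : Matrix.unitaryGroup (Fin d → Fin 2) ℂ) (x z : Fin d → ℝ) :
    kernel φ V x z = ∏ i, qubitKernel (φ i) (x i) (z i) := by
  have h1 : ∀ u v : (Fin d → Fin 2) → ℂ,
      (density u * density v).trace = star (star u ⬝ᵥ v) * (star u ⬝ᵥ v) := fun u v => by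
    rw [density, density, Matrix.vecMulVec_mul_vecMulVec, Matrix.vecMulVec_smul, Matrix.trace_smul,
      Matrix.trace_vecMulVec, smul_eq_mul, mul_comm]
    simp [dotProduct, mul_comm]
  have h2 : ∀ u v : (Fin d → Fin 2) → ℂ,
      star ((V : Matrix (Fin d → Fin 2) (Fin d → Fin 2) ℂ).mulVec u) ⬝ᵥ
        (V : Matrix (Fin d → Fin 2) (Fin d → Fin 2) ℂ).mulVec v = star u ⬝ᵥ v := fun u v => by
    rw [Matrix.star_mulVec, Matrix.dotProduct_mulVec, Matrix.vecMul_vecMul,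
      ← Matrix.star_eq_conjTranspose, Matrix.UnitaryGroup.star_mul_self, Matrix.vecMul_one]
  have h3 : star (productState φ x) ⬝ᵥ productState φ z =
      ∏ i, ∑ b, star (φ i (x i) b) * φ i (z i) b := by
    rw [Finset.prod_univ_sum]
    simp [dotProduct, productState, Finset.prod_mul_distrib]
  rw [kernel, featureMap, featureMap, h1, h2, h3, RCLike.star_def, Complex.conj_mul']
  rw [← Complex.ofReal_pow, Complex.ofReal_re, norm_prod, ← Finset.prod_pow]
  rfl

lemma isUnitKernel_prod {k : Fin d → ℝ → ℝ → ℝ} (hk : ∀ i, IsUnitKernel (k i)) :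
    IsUnitKernel fun x z : Fin d → ℝ => ∏ i, k i (x i) (z i) where
  measurable := by
    have h : ∀ i, Measurable fun p : (Fin d → ℝ) × (Fin d → ℝ) => (p.1 i, p.2 i) := fun i =>
      ((measurable_pi_apply i).comp measurable_fst).prodMk
        ((measurable_pi_apply i).comp measurable_snd)
    exact Finset.measurable_fun_prod _ fun i _ => (hk i).measurable.comp (h i)
  nonneg _ _ := Finset.prod_nonneg fun i _ => (hk i).nonneg _ _
  le_one _ _ := Finset.prod_le_one (fun i _ => (hk i).nonneg _ _) fun i _ => (hk i).le_one _ _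
  diag _ := Finset.prod_eq_one fun i _ => (hk i).diag _

variable (μ : Fin d → Measure ℝ) [∀ i, IsProbabilityMeasure (μ i)]

lemma integral_integral_prod (g : Fin d → ℝ → ℝ → ℝ) :
    ∫ x, ∫ z, ∏ i, g i (x i) (z i) ∂(Measure.pi μ) ∂(Measure.pi μ) =
      ∏ i, ∫ x, ∫ z, g i x z ∂(μ i) ∂(μ i) := by
  simp only [fun x : Fin d → ℝ => integral_fintype_prod_eq_prod (μ := μ) fun i => g i (x i)]
  exact integral_fintype_prod_eq_prod (μ := μ) fun i x => ∫ z, g i x z ∂(μ i)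

lemma cosSq_prod (k : Fin d → ℝ → ℝ → ℝ) (x x' : Fin d → ℝ) :
    cosSq (Measure.pi μ) (fun x z : Fin d → ℝ => ∏ i, k i (x i) (z i)) x x' =
      ∏ i, cosSq (μ i) (k i) (x i) (x' i) := by
  have h : ∀ x x', gram (Measure.pi μ) (fun x z : Fin d → ℝ => ∏ i, k i (x i) (z i)) x x' =
      ∏ i, gram (μ i) (k i) (x i) (x' i) := fun x x' => by
    simp only [gram, ← Finset.prod_mul_distrib]
    exact integral_fintype_prod_eq_prod (μ := μ) fun i z => k i (x i) z * k i (x' i) z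
  simp only [cosSq, h, Finset.prod_div_distrib, Finset.prod_mul_distrib, Finset.prod_pow]

end Product

end QuantumKernel

end

/-! ### Choice of constants and conclusion. -/

open QuantumKernel

theorem theorem1 (δ : ℝ) (hδ : δ < 1) (l : ℕ) (ε : ℝ) (hε : 0 < ε) :
    ∃ d₀ : ℕ, ∀ d : ℕ, d₀ ≤ d → ∀ n : ℕ, n ≤ d ^ l →
      ∀ (μ : Fin d → Measure ℝ) [∀ i, IsProbabilityMeasure (μ i)]
        (φ : Fin d → ℝ → Fin 2 → ℂ) (V : Matrix.unitaryGroup (Fin d → Fin 2) ℂ),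
        (∀ i, QuantumKernel.IsQubitEmbedding (φ i)) →
        (∀ i, QuantumKernel.purity (QuantumKernel.meanDensity (φ i) (μ i)) ≤ δ) →
        ∀ f : (Fin d → ℝ) → ℝ, MemLp f 2 (Measure.pi μ) →
        ∀ (D : Measure ((Fin d → ℝ) × ℝ)) [IsProbabilityMeasure D],
          QuantumKernel.IsRegressionLaw D (Measure.pi μ) f →
          (Measure.pi fun _ : Fin n => D)
            {S | ¬ ∀ t : ℝ, 0 ≤ t →
              IsUnit (QuantumKernel.ridgeMatrix (QuantumKernel.kernel φ V) S t) ∧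
              ENNReal.ofReal ((1 - ε) * ∫ x, f x ^ 2 ∂(Measure.pi μ)) ≤
                QuantumKernel.risk D (QuantumKernel.krr (QuantumKernel.kernel φ V) S t)}
            ≤ ENNReal.ofReal ε := by
  -- δ may be negative, while the powers of the bound need a nonnegative base.
  set δ' := max δ 0 with hδ'
  have hδ0 : 0 ≤ δ' := le_max_right _ _
  have hδ1 : δ' < 1 := max_lt hδ one_pos
  set c : ℝ := 1 - (1 - δ') ^ 2 / (2 * Fintype.card (Fin 2 × Fin 2) ^ 2) with hc
  have hcard : (Fintype.card (Fin 2 × Fin 2) : ℝ) = 4 := by norm_num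
  have hc0 : 0 ≤ c := by rw [hc, hcard]; nlinarith
  have hc1 : c < 1 := by rw [hc, hcard]; nlinarith
  -- This lets the single rate √c control both the mean kernel value, at most δ'^d, and the mean
  -- squared cosine, at most c^d = (√c^d)².
  have hδc : δ' ≤ √c := Real.le_sqrt_of_sq_le (by rw [hc, hcard]; nlinarith)
  have hs0 : 0 ≤ √c := Real.sqrt_nonneg _
  have hs1 : √c < 1 := by rw [Real.sqrt_lt' one_pos]; simpa using hc1
  have hlim := (tendsto_pow_const_mul_const_pow_of_abs_lt_one (2 * l)
    (by rwa [abs_of_nonneg hs0] : |√c| < 1)).mul_const (5 + 2 / ε)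
  rw [zero_mul] at hlim
  obtain ⟨d₀, hd₀⟩ := Filter.eventually_atTop.1 (hlim.eventually (gt_mem_nhds hε))
  refine ⟨d₀, fun d hd n hn μ _ φ V hφ hpur f hf D _ hD => ?_⟩
  have hker : kernel φ V = fun x z => ∏ i, qubitKernel (φ i) (x i) (z i) := by
    ext x z; exact kernel_eq_prod_qubitKernel φ V x z
  rw [hker]
  have hk := isUnitKernel_prod fun i => (hφ i).isUnitKernel
  have h1 : ∀ i, ∫ x, ∫ z, qubitKernel (φ i) x z ∂(μ i) ∂(μ i) ≤ δ' := fun i => by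
    rw [(hφ i).integral_integral_qubitKernel]
    exact (hpur i).trans (le_max_left _ _)
  have h2 : ∀ i, ∫ x, ∫ z, cosSq (μ i) (qubitKernel (φ i)) x z ∂(μ i) ∂(μ i) ≤ c := fun i =>
    integral_integral_cosSq_le (hφ i).isUnitKernel (hφ i).measurable_qubitFeature
      (qubitKernel_eq_sum (φ i)) hδ1.le (h1 i)
  have h0 : ∀ (g : Fin d → ℝ → ℝ → ℝ) (r : ℝ), (∀ i x z, 0 ≤ g i x z) →
      (∀ i, ∫ x, ∫ z, g i x z ∂(μ i) ∂(μ i) ≤ r) →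
      ∏ i, ∫ x, ∫ z, g i x z ∂(μ i) ∂(μ i) ≤ r ^ d := fun g r hg hr => by
    refine (Finset.prod_le_prod (fun i _ => integral_nonneg fun x => integral_nonneg fun z =>
      hg i x z) fun i _ => hr i).trans_eq ?_
    simp
  refine (measure_not_le_risk_krr_le hk hf hD n hε (η := √c ^ d) (by positivity)
    (pow_le_one₀ hs0 hs1.le) ?_ ?_).trans (ENNReal.ofReal_le_ofReal ?_)
  · rw [integral_integral_prod]
    exact (h0 _ _ (fun i => (hφ i).isUnitKernel.nonneg) h1).trans (pow_le_pow_left₀ hδ0 hδc d)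
  · simp only [cosSq_prod]
    rw [integral_integral_prod, ← pow_mul, mul_comm, pow_mul, Real.sq_sqrt hc0]
    exact h0 _ _ (fun i => cosSq_nonneg (hφ i).isUnitKernel) h2
  · have hn' : (n : ℝ) ^ 2 ≤ (d : ℝ) ^ (2 * l) := by
      rw [mul_comm, pow_mul]
      exact pow_le_pow_left₀ (by positivity) (by exact_mod_cast hn) 2
    calc (n : ℝ) ^ 2 * ((5 + 2 / ε) * √c ^ d) ≤ (d : ℝ) ^ (2 * l) * ((5 + 2 / ε) * √c ^ d) := by
          gcongr
      _ = (d : ℝ) ^ (2 * l) * √c ^ d * (5 + 2 / ε) := by ring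
      _ ≤ ε := (hd₀ d hd).le
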